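/- Let $\Omega\subset\mathbb C$ be open and connected (non-empty), and $\Omega^*=\{\lambda:\bar\lambda\in\Omega\}$. For a positive integer $n$, $\mathcal B_n(\Omega)$ is the class of bounded operators $T$ on a complex Hilbert space $\mathcal H$ such that $\Omega\subset\sigma(T)$, and for all $w\in\Omega$, $T-w$ is surjective with $\dim\ker(T-w)=n$, and $\bigvee_{w\in\Omega}\ker(T-w)=\mathcal H$. An operator is irreducible if its commutant contains no self-adjoint idempotent other than $0$ and $I$; $\sim_u$ denotes unitary equivalence. We write $T=(M_z^*,\mathcal H,K)\in\mathcal B_n(\Omega)$ if $T\in\mathcal B_n(\Omega)$ is the adjoint of multiplication by $z$ on a Hilbert space $\mathcal H$ of holomorphic $\mathbb C^n$-valued functions on $\Omega^*$ with matrix-valued reproducing kernel $K(\mu,\lambda)$, where $K(\lambda,\lambda)$ is invertible for every $\lambda\in\Omega^*$. An (IR) decomposition of $T\in\mathcal B_N(\Omega)$ is $T=\bigoplus_{i=1}^t T_i^{(m_i)}$ with $m_i\ge 1$, $T_i\in\mathcal B_{n_i}(\Omega)$ irreducible, $T_i\not\sim_u T_j$ for $i\ne j$, and $\sum_i m_in_i=N$.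 Let $T=\bigoplus_{i=1}^{t}T_i^{(m_i)}$ and $\widetilde T=\bigoplus_{j=1}^{s}\widetilde T_j^{(l_j)}$ be (IR) decompositions of two unitarily equivalent operators in $\mathcal B_N(\Omega)$, where each $T_i\in\mathcal B_{n_i}(\Omega)$ and each $\widetilde T_j\in\mathcal B_{h_j}(\Omega)$ is given in the form $(M_z^*,\cdot,\cdot)$. List the summands with multiplicity as $S_1,\dots,S_k$ (first the $m_1$ copies of $T_1$, then the $m_2$ copies of $T_2$, and so on) and $\widetilde S_1,\dots,\widetilde S_{\tilde k}$, with kernels $K_1,\dots,K_k$ and $\widetilde K_1,\dots,\widetilde K_{\tilde k}$, and put $K=\mathrm{diag}(K_1,\dots,K_k)$, $\widetilde K=\mathrm{diag}(\widetilde K_1,\dots,\widetilde K_{\tilde k})$. Then $t=s$; there is a holomorphic, pointwise invertible matrix function $\Phi$ on $\Omega^*$ with $K(\mu,\lambda)=\Phi(\mu)\widetilde K(\mu,\lambda)\Phi(\lambda)^*$ for all $\mu,\lambda\in\Omega^*$; and there is a bijection $\pi$ from $\{1,\dots,t\}$ onto $\{1,\dots,s\}$ with $T_i\sim_u\widetilde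 T_{\pi(i)}$ and $m_i=l_{\pi(i)}$ for all $i$, such that the following holds for every non-empty open $\Lambda\subset\Omega^*$ and every holomorphic, pointwise invertible matrix function $\Phi$ on $\Lambda$ with $K(\mu,\lambda)=\Phi(\mu)\widetilde K(\mu,\lambda)\Phi(\lambda)^*$ for all $\mu,\lambda\in\Lambda$. 1. Partition $\Phi=(\widetilde\Phi_{i,j})$, $1\le i\le t$, $1\le j\le s$, where $\widetilde\Phi_{i,j}$ has its rows in the $m_i$ copies of $T_i$ and its columns in the $l_j$ copies of $\widetilde T_j$. Then for each $i$, $\widetilde\Phi_{i,\pi(i)}(\mu)\neq0$ for every $\mu\in\Lambda$, and $\widetilde\Phi_{i,j}\equiv0$ for all $j\ne\pi(i)$. 2. Partition $\Phi=(\Phi_{a,b})$, $1\le a\le k$, $1\le b\le\tilde k$, according to the summands $S_a$ and $\widetilde S_b$. Then each $\Phi_{a,b}$ is either invertible at every point of $\Lambda$ or identically zero on $\Lambda$. 3. There are real constants $c_{a,b}\ge0$ with $\sum_b c_{a,b}=1$ for every $a$ and $\sum_a c_{a,b}=1$ for every $b$ such that, with $\Psi=\Phi^{-1}=(\Psi_{b,a})$,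 one has $\Phi_{a,b}\Psi_{b,a}=c_{a,b}I$, $\Psi_{b,a}\Phi_{a,b}=c_{a,b}I$ on $\Lambda$, and $c_{a,b}K_a(\mu,\lambda)=\Phi_{a,b}(\mu)\widetilde K_b(\mu,\lambda)\Phi_{a,b}(\lambda)^*$ for $\mu,\lambda\in\Lambda$. -/

import Mathlib

open scoped Matrix ComplexConjugate

noncomputable section

/-- The reflected domain `Ω* = {λ : conj λ ∈ Ω}`. -/
def conjDomain (Ω : Set ℂ) : Set ℂ := {z | conj z ∈ Ω}

/-- The Cowen-Douglas class `B_n(Ω)` (for a domain `Ω` and a positive integer `n`). -/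
structure CowenDouglas (Ω : Set ℂ) (n : ℕ) {H : Type*} [NormedAddCommGroup H]
    [InnerProductSpace ℂ H] (T : H →L[ℂ] H) : Prop where
  rank_pos : 0 < n
  subset_spectrum : Ω ⊆ spectrum ℂ T
  surjective : ∀ w ∈ Ω, Function.Surjective (T - w • ContinuousLinearMap.id ℂ H)
  dense_span : (⨆ w ∈ Ω, LinearMap.ker (T - w • ContinuousLinearMap.id ℂ H).toLinearMap
    ).topologicalClosure = ⊤
  finrank_ker : ∀ w ∈ Ω,
    Module.finrank ℂ (LinearMap.ker (T - w • ContinuousLinearMap.id ℂ H).toLinearMap) = n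

/-- Unitary equivalence of operators, possibly on different Hilbert spaces. -/
def UnitarilyEquivalent {H H' : Type*} [NormedAddCommGroup H] [InnerProductSpace ℂ H]
    [NormedAddCommGroup H'] [InnerProductSpace ℂ H'] (T : H →L[ℂ] H) (T' : H' →L[ℂ] H') : Prop :=
  ∃ U : H ≃ₗᵢ[ℂ] H', ∀ x, U (T x) = T' (U x)

/-- `T ∈ (IR)`: the commutant of `T` has no nontrivial self-adjoint idempotent. -/
def IsIrreducibleOperator {H : Type*} [NormedAddCommGroup H] [InnerProductSpace ℂ H]
    [CompleteSpace H] (T : H →L[ℂ] H) : Prop :=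
  ∀ P : H →L[ℂ] H, IsSelfAdjoint P → IsIdempotentElem P → Commute P T → P = 0 ∨ P = 1

/-- Indices of the summands of `⨁ i, T i ^ (m i)`: the pair `⟨i, p⟩` is the `p`-th copy of `T i`. -/
abbrev Copies {t : ℕ} (m : Fin t → ℕ) : Type := Σ i : Fin t, Fin (m i)

/-- Coordinates of `ℂ^N`, `N = ∑ i, m i * n i`, grouped by the summands: each copy of `T i`
contributes `n i` coordinates. -/
abbrev Coords {t : ℕ} (m n : Fin t → ℕ) : Type := Σ a : Copies m, Fin (n a.1)

/-- The operator `⨁ i, T i ^ (m i)` on the Hilbert space direct sum `⨁ i, H i ^ (m i)`. -/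
def multDirectSum {t : ℕ} {H : Fin t → Type*} [∀ i, NormedAddCommGroup (H i)]
    [∀ i, InnerProductSpace ℂ (H i)] (m : Fin t → ℕ) (T : ∀ i, H i →L[ℂ] H i) :
    PiLp 2 (fun a : Copies m => H a.1) →L[ℂ] PiLp 2 (fun a : Copies m => H a.1) :=
  (PiLp.continuousLinearEquiv 2 ℂ (fun a : Copies m => H a.1)).symm.toContinuousLinearMap ∘L
    ContinuousLinearMap.pi
      (fun a : Copies m => T a.1 ∘L PiLp.proj 2 (𝕜 := ℂ) (fun a : Copies m => H a.1) a)

/-- `⨁ i, T i ^ (m i)` is an (IR) decomposition of an operator in `B_N(Ω)`,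
with `T i ∈ B_{n i}(Ω)`. -/
structure IsIRDecomposition (Ω : Set ℂ) (N : ℕ) {t : ℕ} {H : Fin t → Type*}
    [∀ i, NormedAddCommGroup (H i)] [∀ i, InnerProductSpace ℂ (H i)] [∀ i, CompleteSpace (H i)]
    (m n : Fin t → ℕ) (T : ∀ i, H i →L[ℂ] H i) : Prop where
  mem : CowenDouglas Ω N (multDirectSum m T)
  sum_eq : ∑ i, m i * n i = N
  mult_pos : ∀ i, 0 < m i
  summand_mem : ∀ i, CowenDouglas Ω (n i) (T i)
  irreducible : ∀ i, IsIrreducibleOperator (T i)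
  not_equivalent : ∀ i j, i ≠ j → ¬ UnitarilyEquivalent (T i) (T j)

/-- The reproducing kernel `K(μ, λ)` of a Hilbert space of `ℂⁿ`-valued functions, as a matrix:
`K(·, λ) ξ` is the element of `H` with `⟨f, K(·, λ) ξ⟩ = ⟨f(λ), ξ⟩`. -/
def kernelMatrix {X : Type*} {n : ℕ} (H : Type*) [NormedAddCommGroup H] [InnerProductSpace ℂ H]
    [CompleteSpace H] [RKHS ℂ H X (EuclideanSpace ℂ (Fin n))] (μ lam : X) :
    Matrix (Fin n) (Fin n) ℂ :=
  Matrix.of fun x y => RKHS.kernel H μ lam (EuclideanSpace.single y 1) x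

/-- `T = (M_z^*, H, K)`: `H` is a Hilbert space of holomorphic `ℂⁿ`-valued functions on `Ω*`
whose reproducing kernel `K` has invertible values `K(λ, λ)`, and `T` is the adjoint of the
multiplication operator `M_z` on `H`. -/
structure IsAdjointMulModel (Ω : Set ℂ) (n : ℕ) {H : Type*} [NormedAddCommGroup H]
    [InnerProductSpace ℂ H] [CompleteSpace H]
    [RKHS ℂ H (conjDomain Ω) (EuclideanSpace ℂ (Fin n))] (T : H →L[ℂ] H) : Prop where
  holomorphic : ∀ f : H, ∃ g : ℂ → EuclideanSpace ℂ (Fin n),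
    DifferentiableOn ℂ g (conjDomain Ω) ∧ ∀ z : conjDomain Ω, g z = f z
  adjoint_apply : ∀ (f : H) (z : conjDomain Ω), (ContinuousLinearMap.adjoint T f) z = (z : ℂ) • f z
  kernel_invertible : ∀ z : conjDomain Ω, IsUnit (kernelMatrix H z z)

/-- The kernel `K = diag(K_1, …, K_k)` of `⨁ i, H i ^ (m i)`, one diagonal block per summand. -/
def sumKernel {X : Type*} {t : ℕ} (m n : Fin t → ℕ) (H : Fin t → Type*)
    [∀ i, NormedAddCommGroup (H i)] [∀ i, InnerProductSpace ℂ (H i)] [∀ i, CompleteSpace (H i)]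
    [∀ i, RKHS ℂ (H i) X (EuclideanSpace ℂ (Fin (n i)))] (μ lam : X) :
    Matrix (Coords m n) (Coords m n) ℂ :=
  Matrix.blockDiagonal' fun a : Copies m => kernelMatrix (H a.1) μ lam

/-- Invertibility of a matrix whose rows and columns may be indexed by different finite types. -/
def MatrixInvertible {p q : Type*} [Fintype p] [Fintype q] [DecidableEq p] [DecidableEq q]
    (A : Matrix p q ℂ) : Prop :=
  ∃ B : Matrix q p ℂ, A * B = 1 ∧ B * A = 1

/-- The block of `A` belonging to the summands `a` (rows) and `b` (columns). -/
def summandBlock {t s : ℕ} {m n : Fin t → ℕ} {l h : Fin s → ℕ}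
    (A : Matrix (Coords m n) (Coords l h) ℂ) (a : Copies m) (b : Copies l) :
    Matrix (Fin (n a.1)) (Fin (h b.1)) ℂ :=
  Matrix.of fun x y => A ⟨a, x⟩ ⟨b, y⟩

/-- The block of `A` belonging to all copies of the `i`-th operator (rows) and all copies of
the `j`-th operator (columns); it consists of `m i` times `l j` summand blocks. -/
def isotypicBlock {t s : ℕ} {m n : Fin t → ℕ} {l h : Fin s → ℕ}
    (A : Matrix (Coords m n) (Coords l h) ℂ) (i : Fin t) (j : Fin s) :
    Matrix (Fin (m i) × Fin (n i)) (Fin (l j) × Fin (h j)) ℂ :=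
  Matrix.of fun x y => A ⟨⟨i, x.1⟩, x.2⟩ ⟨⟨j, y.1⟩, y.2⟩

/-- `Φ` is a holomorphic, pointwise invertible matrix function on `L` with
`K(μ, λ) = Φ(μ) K'(μ, λ) Φ(λ)^*` for `μ, λ ∈ L`. -/
structure IntertwinesKernels {D L : Set ℂ} {p q : Type*} [Fintype p] [Fintype q] [DecidableEq p]
    [DecidableEq q] (hL : L ⊆ D) (K : D → D → Matrix p p ℂ) (K' : D → D → Matrix q q ℂ)
    (Φ : ℂ → Matrix p q ℂ) : Prop where
  holomorphic : ∀ x y, DifferentiableOn ℂ (fun z => Φ z x y) L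
  invertible : ∀ z ∈ L, MatrixInvertible (Φ z)
  kernel_eq : ∀ μ lam (hμ : μ ∈ L) (hlam : lam ∈ L),
    K ⟨μ, hL hμ⟩ ⟨lam, hL hlam⟩ = Φ μ * K' ⟨μ, hL hμ⟩ ⟨lam, hL hlam⟩ * (Φ lam)ᴴ

end

/-! The kernel functions `K(·, z) eₓ` are eigenvectors of `M_z^*` for `conj z` and span that
eigenspace. Solutions of `K = Φ K̃ Φ*` are therefore the coefficient matrices, in these frames, of
unitaries `U` intertwining the two operators. Given `Φ` on a non-empty open set, the kernel
functions there and their images under `Φ` are total with equal Gram matrices, which produces `U`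
(`exists_unitary_of_intertwinesKernels`); conversely `U` preserves eigenspaces and its coefficients
are holomorphic (`exists_intertwinesKernels_of_unitary`).

Both `U` and `U⁻¹ = U*` intertwine, so each block `U_ab` and its adjoint intertwine irreducible
operators. Schur's lemma (`IsIrreducibleOperator.schur`) gives `U_ab* U_ab = c_ab` and `U_ab U_ab* =
c_ab`, with `c_ab ≠ 0` only for equivalent summands. Unitarity of `U` makes `c` doubly stochastic.
Since the summands within one decomposition are pairwise inequivalent, the support of `c` matches
the operators bijectively, and a double count of `c` matches the multiplicities
(`exists_equiv_of_doublyStochastic`). The assertions on the blocks of `Φ` are these relations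
written in the kernel frames. -/

section UnitaryEquivalence

variable {E E' E'' : Type*} [NormedAddCommGroup E] [InnerProductSpace ℂ E]
  [NormedAddCommGroup E'] [InnerProductSpace ℂ E']
  [NormedAddCommGroup E''] [InnerProductSpace ℂ E'']

theorem UnitarilyEquivalent.symm {T : E →L[ℂ] E} {T' : E' →L[ℂ] E'}
    (h : UnitarilyEquivalent T T') : UnitarilyEquivalent T' T := by
  obtain ⟨U, hU⟩ := h
  exact ⟨U.symm, fun x => by rw [LinearIsometryEquiv.symm_apply_eq, hU]; simp⟩

theorem UnitarilyEquivalent.trans {T : E →L[ℂ] E} {T' : E' →L[ℂ] E'} {T'' : E'' →L[ℂ] E''}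
    (h : UnitarilyEquivalent T T') (h' : UnitarilyEquivalent T' T'') :
    UnitarilyEquivalent T T'' := by
  obtain ⟨U, hU⟩ := h
  obtain ⟨V, hV⟩ := h'
  exact ⟨U.trans V, fun x => by simp [hU, hV]⟩

end UnitaryEquivalence

/-! ### Schur's lemma for irreducible operators -/

section Schur

open ContinuousLinearMap

variable {E E' : Type*} [NormedAddCommGroup E] [InnerProductSpace ℂ E] [CompleteSpace E]
  [NormedAddCommGroup E'] [InnerProductSpace ℂ E'] [CompleteSpace E']

/-- A self-adjoint operator commuting with an irreducible operator is injective or zero. -/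
theorem IsIrreducibleOperator.ker_eq_bot_or_eq_zero {T : E →L[ℂ] E} (hT : IsIrreducibleOperator T)
    {B : E →L[ℂ] E} (hB : IsSelfAdjoint B) (hBT : Commute B T) :
    B.ker = ⊥ ∨ B = 0 := by
  have : CompleteSpace B.ker := B.isClosed_ker.completeSpace_coe
  have hcomm : ∀ x, B (T x) = T (B x) := fun x => by
    simpa using congrArg (fun S : E →L[ℂ] E => S x) hBT.eq
  have hBT' : Commute B (adjoint T) := by
    have := congrArg star hBT.eq
    rw [star_mul, star_mul, hB.star_eq] at this
    exact this.symm
  have hcomm' : ∀ x, B (adjoint T x) = adjoint T (B x) := fun x => by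
    simpa using congrArg (fun S : E →L[ℂ] E => S x) hBT'.eq
  have h1 : IsSelfAdjoint B.ker.starProjection := isSelfAdjoint_starProjection _
  have h2 : IsIdempotentElem B.ker.starProjection := Submodule.isIdempotentElem_starProjection _
  have h3 : Commute B.ker.starProjection T := by
    -- A projection commutes with `T` iff its range and kernel are both `T`-invariant. The kernel
    -- here is the orthogonal complement of `B.ker`, which is `T`-invariant because `B` also
    -- commutes with `adjoint T`.
    rw [ContinuousLinearMap.IsIdempotentElem.commute_iff h2]
    constructor
    · rw [Submodule.range_starProjection]
      intro x hx
      simp only [Submodule.mem_comap, LinearMap.mem_ker] at hx ⊢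
      have hx : B x = 0 := hx
      change B (T x) = 0
      rw [hcomm, hx, map_zero]
    · rw [Submodule.ker_starProjection]
      refine orthogonal_mem_invtSubmodule ?_
      intro x hx
      have hx : B x = 0 := hx
      change B (adjoint T x) = 0
      rw [hcomm', hx, map_zero]
  rcases hT _ h1 h2 h3 with h | h
  · left
    rw [← Submodule.range_starProjection B.ker, h]
    exact LinearMap.range_zero
  · right
    ext x
    have : x ∈ B.ker := by
      rw [← Submodule.range_starProjection B.ker, h]
      exact ⟨x, rfl⟩
    exact this

/-- Two distinct spectral points of `A` would give, by functional calculus, two non-zero operators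
`f(A)`, `g(A)` with product zero, commuting with `T`; but `f(A)` is injective or zero. So the
spectrum has at most one point. -/
theorem IsIrreducibleOperator.exists_eq_smul_one {T : E →L[ℂ] E} (hT : IsIrreducibleOperator T)
    {A : E →L[ℂ] E} (hA : IsSelfAdjoint A) (hAT : Commute A T) :
    ∃ r : ℝ, A = (r : ℂ) • (1 : E →L[ℂ] E) := by
  have hsub : (spectrum ℝ A).Subsingleton := by
    intro x hx y hy
    by_contra hxy
    wlog hlt : x < y generalizing x y
    · exact this hy hx (Ne.symm hxy) (lt_of_le_of_ne (not_lt.mp hlt) (Ne.symm hxy))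
    -- The ramps `f` and `g` live on opposite sides of the midpoint `s`, so `f * g = 0` while `g x ≠
    -- 0` and `f y ≠ 0`.
    set s := (x + y) / 2
    let f : ℝ → ℝ := fun u => max (u - s) 0
    let g : ℝ → ℝ := fun u => max (s - u) 0
    have hf : Continuous f := by fun_prop
    have hg : Continuous g := by fun_prop
    have hne : ∀ (q : ℝ → ℝ), Continuous q → ∀ u ∈ spectrum ℝ A, q u ≠ 0 → cfc q A ≠ 0 := by
      intro q hq u hu hqu h0
      have hm : q u ∈ spectrum ℝ (cfc q A) := by
        rw [cfc_map_spectrum q A]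
        exact ⟨u, hu, rfl⟩
      rw [h0] at hm
      -- In the zero algebra every spectrum is empty, so a spectral point forces nontriviality.
      have : Nontrivial (E →L[ℂ] E) := by
        by_contra hn
        rw [not_nontrivial_iff_subsingleton] at hn
        simp [spectrum.of_subsingleton] at hm
      rw [spectrum.zero_eq] at hm
      exact hqu hm
    have hfg : cfc f A * cfc g A = 0 := by
      rw [← cfc_mul f g A]
      have : (fun u => f u * g u) = fun _ => (0 : ℝ) := by
        funext u
        rcases le_total u s with h | h
        · simp [f, max_eq_right (sub_nonpos.mpr h)]
        · simp [g, max_eq_right (sub_nonpos.mpr h)]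
      rw [this]
      simp
    rcases hT.ker_eq_bot_or_eq_zero (B := cfc f A) (cfc_predicate f A) (hA.commute_cfc hAT f)
      with h | h
    · refine hne g hg x hx ?_ ?_
      · simp only [g, s]
        rw [max_eq_left (by linarith)]
        intro h; linarith
      · ext v
        have : cfc g A v ∈ (cfc f A).ker := congrArg (fun S : E →L[ℂ] E => S v) hfg
        rw [h] at this
        simpa using this
    · refine hne f hf y hy ?_ h
      simp only [f, s]
      rw [max_eq_left (by linarith)]
      intro h; linarith
  rcases (spectrum ℝ A).eq_empty_or_nonempty with h0 | ⟨r, hr⟩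
  · refine ⟨0, ?_⟩
    have := CFC.eq_algebraMap_of_spectrum_subset_singleton (R := ℝ) A 0 (by simp [h0]) hA
    simpa using this
  · refine ⟨r, ?_⟩
    have := CFC.eq_algebraMap_of_spectrum_subset_singleton (R := ℝ) A r
      (fun u hu => hsub hu hr) hA
    rw [this, Algebra.algebraMap_eq_smul_one]
    ext v
    simp

/-- **Schur's lemma** for irreducible operators: an intertwiner of two irreducible operators whose
adjoint is an intertwiner as well is a multiple of a unitary operator. -/
theorem IsIrreducibleOperator.schur {T : E →L[ℂ] E} {T' : E' →L[ℂ] E'}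
    (hT : IsIrreducibleOperator T) (hT' : IsIrreducibleOperator T')
    {V : E →L[ℂ] E'} {W : E' →L[ℂ] E} (hVW : ∀ x y, inner ℂ (V x) y = inner ℂ x (W y))
    (hV : ∀ x, V (T x) = T' (V x)) (hW : ∀ y, W (T' y) = T (W y)) :
    ∃ c : ℝ, 0 ≤ c ∧ (∀ x, W (V x) = (c : ℂ) • x) ∧ (∀ y, V (W y) = (c : ℂ) • y) ∧
      (c ≠ 0 → UnitarilyEquivalent T T') := by
  have hVW' : ∀ y x, inner ℂ (W y) x = inner ℂ y (V x) := fun y x => by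
    rw [← inner_conj_symm, ← hVW, inner_conj_symm]
  obtain ⟨r, hr⟩ := hT.exists_eq_smul_one (A := W ∘L V)
    (by rw [isSelfAdjoint_iff_isSymmetric]; intro x y; simp [hVW', hVW])
    (by ext x; simp [hV, hW])
  obtain ⟨r', hr'⟩ := hT'.exists_eq_smul_one (A := V ∘L W)
    (by rw [isSelfAdjoint_iff_isSymmetric]; intro x y; simp [hVW', hVW])
    (by ext x; simp [hV, hW])
  have h1 : ∀ x, W (V x) = (r : ℂ) • x := fun x => by
    simpa using congrArg (fun S : E →L[ℂ] E => S x) hr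
  have h2 : ∀ y, V (W y) = (r' : ℂ) • y := fun y => by
    simpa using congrArg (fun S : E' →L[ℂ] E' => S y) hr'
  have hn : ∀ x, ‖V x‖ ^ 2 = r * ‖x‖ ^ 2 := fun x => by
    have : (inner ℂ (V x) (V x) : ℂ) = r * inner ℂ x x := by
      rw [hVW, h1, inner_smul_right]
    rw [inner_self_eq_norm_sq_to_K, inner_self_eq_norm_sq_to_K] at this
    apply Complex.ofReal_injective
    push_cast
    exact this
  -- This case is separate because on a trivial space `r` and `r'` are arbitrary; here the constant
  -- must be `0`.
  by_cases h0 : ∀ x, V x = 0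
  · have hW0 : ∀ y, W y = 0 := fun y => by
      rw [← inner_self_eq_zero (𝕜 := ℂ), hVW', h0, inner_zero_right]
    exact ⟨0, le_rfl, by simp [h0], by simp [hW0], by simp⟩
  push Not at h0
  obtain ⟨x₀, hx₀⟩ := h0
  have hpos : 0 < r := by
    have h3 := hn x₀
    have h4 : 0 < ‖V x₀‖ ^ 2 := by positivity
    by_contra hneg
    have := mul_nonpos_of_nonpos_of_nonneg (not_lt.mp hneg) (sq_nonneg ‖x₀‖)
    linarith
  have hrr : r = r' := by
    have h3 : (r : ℂ) • V x₀ = (r' : ℂ) • V x₀ := by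
      rw [← h2, h1, map_smul]
    have := smul_left_injective ℂ hx₀ h3
    exact_mod_cast this
  subst hrr
  refine ⟨r, hpos.le, h1, h2, fun _ => ?_⟩
  have hs : (Real.sqrt r) ≠ 0 := (Real.sqrt_pos.mpr hpos).ne'
  -- By `hn`, `V / √r` is isometric; `V W = r` makes it onto.
  let U₀ : E →ₗᵢ[ℂ] E' :=
    { toLinearMap := (((Real.sqrt r)⁻¹ : ℝ) : ℂ) • (V : E →ₗ[ℂ] E')
      norm_map' := fun x => by
        simp only [LinearMap.smul_apply, ContinuousLinearMap.coe_coe]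
        rw [norm_smul, Complex.norm_real, Real.norm_of_nonneg (by positivity)]
        have : ‖V x‖ = Real.sqrt r * ‖x‖ := by
          rw [← Real.sqrt_sq (norm_nonneg (V x)), hn, Real.sqrt_mul hpos.le,
            Real.sqrt_sq (norm_nonneg x)]
        rw [this]
        field_simp }
  have hU₀ : ∀ x, U₀ x = (((Real.sqrt r)⁻¹ : ℝ) : ℂ) • V x := fun x => rfl
  have hsurj : Function.Surjective U₀ := fun y => by
    refine ⟨(Real.sqrt r : ℂ) • (r : ℂ)⁻¹ • W y, ?_⟩
    rw [hU₀, map_smul, map_smul, h2, smul_smul, smul_smul, smul_smul]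
    have : (r : ℂ) ≠ 0 := by exact_mod_cast hpos.ne'
    have hs' : (Real.sqrt r : ℂ) ≠ 0 := by exact_mod_cast hs
    push_cast
    rw [inv_mul_cancel₀ hs', one_mul, inv_mul_cancel₀ this, one_smul]
  refine ⟨LinearIsometryEquiv.ofSurjective U₀ hsurj, fun x => ?_⟩
  change U₀ (T x) = T' (U₀ x)
  rw [hU₀, hU₀, hV, map_smul]

end Schur

/-! ### Kernel systems and extension of isometries -/

/-- Vectors `k z x` spanning the eigenspaces of `T`, such that `f ↦ (z ↦ ⟨k z x, f⟩)` identifies the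
Hilbert space with a space of holomorphic functions: the kernel functions `K(·, z) eₓ`. -/
structure IsKernelSystem {D : Set ℂ} {p E : Type*} [NormedAddCommGroup E] [InnerProductSpace ℂ E]
    (T : E →L[ℂ] E) (k : D → p → E) : Prop where
  separating : ∀ f, (∀ z x, inner ℂ (k z x) f = 0) → f = 0
  holomorphic : ∀ f x, ∃ g : ℂ → ℂ, DifferentiableOn ℂ g D ∧
    ∀ z : D, g (z : ℂ) = inner ℂ (k z x) f
  eigen : ∀ (z : D) x, T (k z x) = conj (z : ℂ) • k z x
  linearIndependent : ∀ z, LinearIndependent ℂ (k z)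
  mem_span : ∀ (z : D) f, T f = conj (z : ℂ) • f → f ∈ Submodule.span ℂ (Set.range (k z))

/-- The matrix `K(μ, λ)` of inner products of the vectors of a kernel system. -/
noncomputable def kernelOf {D : Set ℂ} {p E : Type*} [NormedAddCommGroup E] [InnerProductSpace ℂ E]
    (k : D → p → E) (μ lam : D) : Matrix p p ℂ :=
  Matrix.of fun x y => inner ℂ (k μ x) (k lam y)

theorem isOpen_conjDomain {Ω : Set ℂ} (hΩ : IsOpen Ω) : IsOpen (conjDomain Ω) :=
  hΩ.preimage Complex.continuous_conj

theorem isPreconnected_conjDomain {Ω : Set ℂ} (hΩ : IsPreconnected Ω) :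
    IsPreconnected (conjDomain Ω) := by
  have : conjDomain Ω = (starRingEnd ℂ) '' Ω := by
    ext z
    exact ⟨fun hz => ⟨conj z, hz, Complex.conj_conj z⟩, by
      rintro ⟨w, hw, rfl⟩
      simpa [conjDomain] using hw⟩
  rw [this]
  exact hΩ.image _ Complex.continuous_conj.continuousOn

theorem LinearIndependent.eq_of_sum_smul_eq {ι M : Type*} [Fintype ι] [AddCommGroup M] [Module ℂ M]
    {v : ι → M} (hv : LinearIndependent ℂ v) {f g : ι → ℂ}
    (h : ∑ i, f i • v i = ∑ i, g i • v i) : f = g := by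
  have h1 : ∑ i, (f i - g i) • v i = 0 := by simp [sub_smul, h]
  funext i
  exact sub_eq_zero.mp (Fintype.linearIndependent_iff.mp hv _ h1 i)

section Extension

variable {E E' : Type*} [NormedAddCommGroup E] [InnerProductSpace ℂ E] [CompleteSpace E]
  [NormedAddCommGroup E'] [InnerProductSpace ℂ E'] [CompleteSpace E']

/-- Two total families with the same Gram matrix are related by a unitary operator. -/
theorem exists_linearIsometryEquiv_of_inner_eq {I : Type*} {e : I → E} {e' : I → E'}
    (he : (Submodule.span ℂ (Set.range e)).topologicalClosure = ⊤)
    (he' : (Submodule.span ℂ (Set.range e')).topologicalClosure = ⊤)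
    (h : ∀ i j, inner ℂ (e i) (e j) = inner ℂ (e' i) (e' j)) :
    ∃ U : E ≃ₗᵢ[ℂ] E', ∀ i, U (e i) = e' i := by
  have hd : DenseRange (Finsupp.linearCombination ℂ e) := by
    rwa [← Finsupp.range_linearCombination, ← Submodule.dense_iff_topologicalClosure_eq_top] at he
  have hd' : DenseRange (Finsupp.linearCombination ℂ e') := by
    rwa [← Finsupp.range_linearCombination,
      ← Submodule.dense_iff_topologicalClosure_eq_top] at he'
  have hn : ∀ x, ‖Finsupp.linearCombination ℂ e' (LinearEquiv.refl ℂ (I →₀ ℂ) x)‖ =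
      ‖Finsupp.linearCombination ℂ e x‖ := fun x => by
    rw [← sq_eq_sq₀ (norm_nonneg _) (norm_nonneg _)]
    apply Complex.ofReal_injective
    push_cast
    have h1 := inner_self_eq_norm_sq_to_K (𝕜 := ℂ) (Finsupp.linearCombination ℂ e x)
    have h2 := inner_self_eq_norm_sq_to_K (𝕜 := ℂ) (Finsupp.linearCombination ℂ e' x)
    refine (h2.symm.trans ?_).trans h1
    simp only [Finsupp.linearCombination_apply, Finsupp.sum_inner, Finsupp.inner_sum,
      inner_smul_left, inner_smul_right, h]
  -- Finite combinations with the same coefficients have the same norm, since the norm depends only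
  -- on the Gram matrix; the resulting isometry extends by density.
  refine ⟨(LinearEquiv.refl ℂ (I →₀ ℂ)).extendOfIsometry _ _ hd hd' hn, fun i => ?_⟩
  have := LinearEquiv.extendOfIsometry_eq (LinearEquiv.refl ℂ (I →₀ ℂ)) _ _ hd hd' hn
    (Finsupp.single i 1)
  simpa using this

end Extension

/-! ### Solutions of `K = Φ K' Φ*` and intertwining unitaries -/

section Systems

variable {D : Set ℂ} {p q E E' : Type*}
  [NormedAddCommGroup E] [InnerProductSpace ℂ E] [NormedAddCommGroup E'] [InnerProductSpace ℂ E']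
  {T : E →L[ℂ] E} {T' : E' →L[ℂ] E'} {k : D → p → E} {k' : D → q → E'}

/-- The kernel functions at the points of a non-empty open set are total. -/
theorem IsKernelSystem.span_eq_top [CompleteSpace E]
    (hk : IsKernelSystem T k) (hD : IsOpen D)
    (hDc : IsPreconnected D) {L : Set ℂ} (hL : L ⊆ D) (hLo : IsOpen L) (hLn : L.Nonempty) :
    (Submodule.span ℂ (Set.range fun i : L × p => k ⟨i.1, hL i.1.2⟩ i.2)).topologicalClosure
      = ⊤ := by
  rw [Submodule.topologicalClosure_eq_top_iff, Submodule.eq_bot_iff]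
  intro f hf
  have hz : ∀ (z : L) x, inner ℂ (k ⟨z, hL z.2⟩ x) f = 0 := fun z x =>
    (Submodule.mem_orthogonal _ _).mp hf _ (Submodule.subset_span ⟨(z, x), rfl⟩)
  -- The holomorphic function representing `⟨k z x, f⟩` vanishes on `L`, hence on `D` by the
  -- identity theorem.
  refine hk.separating f fun z x => ?_
  obtain ⟨g, hg, hgz⟩ := hk.holomorphic f x
  obtain ⟨z₀, hz₀⟩ := hLn
  have h0 : g =ᶠ[nhds z₀] 0 := by
    filter_upwards [hLo.mem_nhds hz₀] with w hw
    have := hgz ⟨w, hL hw⟩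
    rw [hz ⟨w, hw⟩ x] at this
    exact this
  have := (hg.analyticOnNhd hD).eqOn_zero_of_preconnected_of_eventuallyEq_zero hDc (hL hz₀) h0
  rw [← hgz]
  exact this z.2

/-- Kernel vectors transformed by invertible coefficient matrices are recovered by the inverse. -/
theorem sum_conj_smul_sum_conj_smul [Fintype p] [Fintype q] [DecidableEq q]
    {M : Type*} [AddCommGroup M] [Module ℂ M] {A : Matrix p q ℂ}
    {B : Matrix q p ℂ} (hBA : B * A = 1) (w : q → M) (y : q) :
    ∑ x, conj (B y x) • ∑ y', conj (A x y') • w y' = w y := by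
  simp only [Finset.smul_sum, smul_smul]
  rw [Finset.sum_comm]
  simp only [← Finset.sum_smul, ← map_mul, ← map_sum, ← Matrix.mul_apply, hBA]
  simp [Matrix.one_apply]

/-- The inner product is conjugate-linear in its first argument, so conjugated coefficients are what
turns a change of frame into `A K Bᴴ` without stray conjugates. -/
theorem inner_sum_conj_smul [Fintype q]
    {r : Type*} {F : Type*} [NormedAddCommGroup F]
    [InnerProductSpace ℂ F] (A : Matrix p q ℂ) (B : Matrix r q ℂ) (v w : q → F) (x : p) (y : r) :
    inner ℂ (∑ i, conj (A x i) • v i) (∑ j, conj (B y j) • w j) =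
      (A * Matrix.of (fun i j => inner ℂ (v i) (w j)) * Bᴴ) x y := by
  simp only [sum_inner, inner_sum, inner_smul_left, inner_smul_right, Matrix.mul_apply,
    Matrix.conjTranspose_apply, Matrix.of_apply, Finset.sum_mul, Finset.mul_sum,
    Complex.conj_conj, RCLike.star_def]
  refine Finset.sum_congr rfl fun i _ => Finset.sum_congr rfl fun j _ => ?_
  ring

/-- If `U v = ∑ y, conj (A · y) w` then `U⁻¹` acts on `w` by the inverse matrix of `A`. -/
theorem symm_apply_of_apply_eq_sum [Fintype p] [Fintype q] [DecidableEq q]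
    {U : E ≃ₗᵢ[ℂ] E'} {v : p → E} {w : q → E'}
    {A : Matrix p q ℂ} {B : Matrix q p ℂ} (hBA : B * A = 1)
    (h : ∀ x, U (v x) = ∑ y, conj (A x y) • w y) (y : q) :
    U.symm (w y) = ∑ x, conj (B y x) • v x := by
  rw [LinearIsometryEquiv.symm_apply_eq, map_sum]
  simp only [map_smul, h]
  exact (sum_conj_smul_sum_conj_smul hBA w y).symm

/-- If `W (V v) = c v` for a linearly independent family `v`, then the coefficient matrices
of `V` and `W` have product `c`. -/
theorem mul_eq_smul_one_of_apply_eq_sum [Fintype p] [Fintype q] [DecidableEq p]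
    {V : E →L[ℂ] E'} {W : E' →L[ℂ] E} {c : ℝ}
    (hWV : ∀ f, W (V f) = (c : ℂ) • f) {v : p → E} {w : q → E'} (hv : LinearIndependent ℂ v)
    {A : Matrix p q ℂ} {B : Matrix q p ℂ} (hA : ∀ x, V (v x) = ∑ y, conj (A x y) • w y)
    (hB : ∀ y, W (w y) = ∑ x, conj (B y x) • v x) : A * B = (c : ℂ) • 1 := by
  ext x x'
  have h1 := hWV (v x)
  rw [hA, map_sum] at h1
  simp only [map_smul, hB, Finset.smul_sum, smul_smul] at h1
  rw [Finset.sum_comm] at h1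
  simp only [← Finset.sum_smul, ← map_mul, ← map_sum, ← Matrix.mul_apply] at h1
  have h2 : (c : ℂ) • v x = ∑ i, (if i = x then (c : ℂ) else 0) • v i := by simp [ite_smul]
  have h3 := congrFun (hv.eq_of_sum_smul_eq (h1.trans h2)) x'
  have h4 := congrArg conj h3
  rw [Complex.conj_conj] at h4
  rw [h4, Matrix.smul_apply, Matrix.one_apply]
  by_cases h : x = x'
  · subst h; simp
  · simp [h, Ne.symm h]

theorem mul_eq_one_of_apply_eq_sum [Fintype p] [Fintype q] [DecidableEq p]
    {U : E ≃ₗᵢ[ℂ] E'} {v : p → E} {w : q → E'}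
    (hv : LinearIndependent ℂ v) {A : Matrix p q ℂ} {B : Matrix q p ℂ}
    (hA : ∀ x, U (v x) = ∑ y, conj (A x y) • w y)
    (hB : ∀ y, U.symm (w y) = ∑ x, conj (B y x) • v x) : A * B = 1 := by
  have := mul_eq_smul_one_of_apply_eq_sum (V := (U : E →L[ℂ] E')) (W := (U.symm : E' →L[ℂ] E))
    (c := 1) (by simp) hv hA hB
  simpa using this

/-- A holomorphic solution of `K = Φ K' Φ*` on an open set is implemented by a unitary operator
intertwining the operators. -/
theorem exists_unitary_of_intertwinesKernels [Fintype p] [Fintype q] [DecidableEq p] [DecidableEq q]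
    [CompleteSpace E] [CompleteSpace E']
    (hk : IsKernelSystem T k) (hk' : IsKernelSystem T' k')
    (hD : IsOpen D) (hDc : IsPreconnected D) {L : Set ℂ} (hL : L ⊆ D) (hLo : IsOpen L)
    (hLn : L.Nonempty) {Φ : ℂ → Matrix p q ℂ}
    (hΦ : IntertwinesKernels hL (kernelOf k) (kernelOf k') Φ) :
    ∃ U : E ≃ₗᵢ[ℂ] E', (∀ f, U (T f) = T' (U f)) ∧ ∀ (z : ℂ) (hz : z ∈ L) (x : p),
      U (k ⟨z, hL hz⟩ x) = ∑ y, conj (Φ z x y) • k' ⟨z, hL hz⟩ y := by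
  let e : L × p → E := fun i => k ⟨i.1, hL i.1.2⟩ i.2
  let e' : L × p → E' := fun i => ∑ y, conj (Φ i.1 i.2 y) • k' ⟨i.1, hL i.1.2⟩ y
  have he := hk.span_eq_top hD hDc hL hLo hLn
  have he' : (Submodule.span ℂ (Set.range e')).topologicalClosure = ⊤ := by
    rw [eq_top_iff, ← hk'.span_eq_top hD hDc hL hLo hLn]
    apply Submodule.topologicalClosure_mono
    rw [Submodule.span_le]
    rintro _ ⟨⟨⟨z, hz⟩, y⟩, rfl⟩
    obtain ⟨B, -, hB⟩ := hΦ.invertible z hz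
    have h1 := sum_conj_smul_sum_conj_smul hB (k' ⟨z, hL hz⟩) y
    have h2 : ∀ x, ∑ y', conj (Φ z x y') • k' ⟨z, hL hz⟩ y' = e' (⟨z, hz⟩, x) := fun _ => rfl
    simp only [h2] at h1
    change k' ⟨z, hL hz⟩ y ∈ Submodule.span ℂ (Set.range e')
    rw [← h1]
    exact Submodule.sum_mem _ fun x _ => Submodule.smul_mem _ _ (Submodule.subset_span ⟨_, rfl⟩)
  have hinner : ∀ i j : L × p, inner ℂ (e i) (e j) = inner ℂ (e' i) (e' j) := by
    rintro ⟨⟨μ, hμ⟩, x⟩ ⟨⟨lam, hlam⟩, y⟩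
    have h1 : kernelOf k ⟨μ, hL hμ⟩ ⟨lam, hL hlam⟩ x y =
        (Φ μ * kernelOf k' ⟨μ, hL hμ⟩ ⟨lam, hL hlam⟩ * (Φ lam)ᴴ) x y := by
      rw [← hΦ.kernel_eq μ lam hμ hlam]
    have h2 := inner_sum_conj_smul (Φ μ) (Φ lam) (k' ⟨μ, hL hμ⟩) (k' ⟨lam, hL hlam⟩) x y
    exact h1.trans h2.symm
  obtain ⟨U, hU⟩ := exists_linearIsometryEquiv_of_inner_eq he he' hinner
  have hU' : ∀ (z : ℂ) (hz : z ∈ L) (x : p),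
      U (k ⟨z, hL hz⟩ x) = ∑ y, conj (Φ z x y) • k' ⟨z, hL hz⟩ y := fun z hz x => hU (⟨z, hz⟩, x)
  refine ⟨U, fun f => ?_, hU'⟩
  -- It suffices to compare on the total family `e`: at a fixed `z`, both frames consist of
  -- eigenvectors for the same eigenvalue `conj z`.
  have hext : (U : E →L[ℂ] E') ∘L T = T' ∘L (U : E →L[ℂ] E') := by
    refine ContinuousLinearMap.ext_on (Submodule.dense_iff_topologicalClosure_eq_top.mpr he) ?_
    rintro _ ⟨⟨z, x⟩, rfl⟩
    have h1 := hU' z z.2 x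
    simp only [ContinuousLinearMap.comp_apply, ContinuousLinearEquiv.coe_coe,
      LinearIsometryEquiv.coe_toContinuousLinearEquiv]
    rw [hk.eigen, map_smul, h1, map_sum, Finset.smul_sum]
    refine Finset.sum_congr rfl fun y _ => ?_
    rw [map_smul, hk'.eigen, smul_comm]
  simpa using congrArg (fun S : E →L[ℂ] E' => S f) hext

/-- `U` carries the `conj z`-eigenspace of `T` into that of `T'`, which `k' z` spans. Values off `D`
are set to `0` and play no role. -/
theorem IsKernelSystem.exists_coefficients [Fintype q]
    (hk : IsKernelSystem T k) (hk' : IsKernelSystem T' k')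
    (U : E ≃ₗᵢ[ℂ] E') (hU : ∀ f, U (T f) = T' (U f)) :
    ∃ Φ : ℂ → Matrix p q ℂ, ∀ (z : D) x, U (k z x) = ∑ y, conj (Φ z x y) • k' z y := by
  have : ∀ (z : D) x, ∃ c : q → ℂ, ∑ y, c y • k' z y = U (k z x) := fun z x => by
    have := hk'.mem_span z (U (k z x)) (by rw [← hU, hk.eigen, map_smul])
    exact (Submodule.mem_span_range_iff_exists_fun ℂ).mp this
  choose c hc using this
  classical
  refine ⟨fun z => if hz : z ∈ D then Matrix.of fun x y => conj (c ⟨z, hz⟩ x y) else 0,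
    fun z x => ?_⟩
  simp [hc]

theorem DifferentiableAt.matrix_det {n : Type*} [Fintype n] [DecidableEq n]
    {A : ℂ → Matrix n n ℂ} {z : ℂ} (hA : ∀ i j, DifferentiableAt ℂ (fun w => A w i j) z) :
    DifferentiableAt ℂ (fun w => (A w).det) z := by
  simp only [Matrix.det_apply]
  refine DifferentiableAt.fun_sum fun σ _ => DifferentiableAt.const_smul ?_ _
  exact DifferentiableAt.fun_finsetProd fun i _ => hA _ _

theorem DifferentiableAt.matrix_inv {n : Type*} [Fintype n] [DecidableEq n]
    {A : ℂ → Matrix n n ℂ} {z : ℂ} (hA : ∀ i j, DifferentiableAt ℂ (fun w => A w i j) z)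
    (hz : (A z).det ≠ 0) (i j : n) : DifferentiableAt ℂ (fun w => (A w)⁻¹ i j) z := by
  simp only [Matrix.inv_def, Matrix.smul_apply, Ring.inverse_eq_inv', smul_eq_mul,
    Matrix.adjugate_apply]
  refine ((DifferentiableAt.matrix_det hA).inv hz).mul (DifferentiableAt.matrix_det fun a b => ?_)
  by_cases h : a = j
  · subst h; simp
  · simpa [Matrix.updateRow_ne h] using hA a b

/-- A unitary operator intertwining the operators is given by a holomorphic solution of
`K = Φ K' Φ*`. -/
theorem exists_intertwinesKernels_of_unitary [Fintype p] [Fintype q] [DecidableEq p] [DecidableEq q]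
    (hk : IsKernelSystem T k) (hk' : IsKernelSystem T' k')
    (hD : IsOpen D) (U : E ≃ₗᵢ[ℂ] E') (hU : ∀ f, U (T f) = T' (U f)) :
    ∃ Φ : ℂ → Matrix p q ℂ,
      IntertwinesKernels (subset_refl D) (kernelOf k) (kernelOf k') Φ := by
  obtain ⟨Φ, hΦ⟩ := hk.exists_coefficients hk' U hU
  obtain ⟨Ψ, hΨ⟩ := hk'.exists_coefficients hk U.symm
    (fun f => by rw [LinearIsometryEquiv.symm_apply_eq, hU]; simp)
  refine ⟨Φ, fun x y z₀ hz₀ => ?_, fun z hz => ⟨Ψ z, ?_, ?_⟩, fun μ lam hμ hlam => ?_⟩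
  · refine DifferentiableAt.differentiableWithinAt ?_
    -- Pairing `U (k z x)` with the fixed vectors `k' z₀ y` gives `F = Φ G` with `F`, `G`
    -- holomorphic in `z`. As `G z₀` is the Gram matrix of independent vectors, `G` is invertible
    -- near `z₀` and `Φ = F G⁻¹` there.
    choose G hG hGz using fun w y => hk'.holomorphic (k' ⟨z₀, hz₀⟩ y) w
    choose F hF hFz using fun x y => hk.holomorphic (U.symm (k' ⟨z₀, hz₀⟩ y)) x
    let Gm : ℂ → Matrix q q ℂ := fun z => Matrix.of fun w y => G w y z
    let Fm : ℂ → Matrix p q ℂ := fun z => Matrix.of fun x y => F x y z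
    have hGd : ∀ i j, DifferentiableAt ℂ (fun w => Gm w i j) z₀ := fun i j =>
      (hG i j).differentiableAt (hD.mem_nhds hz₀)
    have hFd : ∀ i j, DifferentiableAt ℂ (fun w => Fm w i j) z₀ := fun i j =>
      (hF i j).differentiableAt (hD.mem_nhds hz₀)
    have hdet : (Gm z₀).det ≠ 0 := by
      have : Gm z₀ = Matrix.gram ℂ (k' ⟨z₀, hz₀⟩) := by
        ext i j
        exact hGz i j ⟨z₀, hz₀⟩
      rw [this, Matrix.det_gram_ne_zero_iff_linearIndependent]
      exact hk'.linearIndependent _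
    have hFG : ∀ z ∈ D, Fm z = Φ z * Gm z := fun z hz => by
      ext x y
      simp only [Fm, Gm, Matrix.of_apply, Matrix.mul_apply]
      rw [hFz x y ⟨z, hz⟩, ← U.inner_map_map, hΦ, sum_inner, LinearIsometryEquiv.apply_symm_apply]
      refine Finset.sum_congr rfl fun w _ => ?_
      rw [hGz w y ⟨z, hz⟩, inner_smul_left, Complex.conj_conj]
    have hev : (fun z => Φ z x y) =ᶠ[nhds z₀] fun z => (Fm z * (Gm z)⁻¹) x y := by
      filter_upwards [hD.mem_nhds hz₀,
        (DifferentiableAt.matrix_det hGd).continuousAt.eventually_ne hdet] with z hz hdz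
      rw [hFG z hz, Matrix.mul_nonsing_inv_cancel_right _ _ (isUnit_iff_ne_zero.mpr hdz)]
    refine DifferentiableAt.congr_of_eventuallyEq ?_ hev
    simp only [Matrix.mul_apply]
    exact DifferentiableAt.fun_sum fun w _ =>
      (hFd x w).mul (DifferentiableAt.matrix_inv hGd hdet w y)
  · exact mul_eq_one_of_apply_eq_sum (U := U) (hk.linearIndependent ⟨z, hz⟩) (hΦ ⟨z, hz⟩)
      (hΨ ⟨z, hz⟩)
  · exact mul_eq_one_of_apply_eq_sum (U := U.symm) (hk'.linearIndependent ⟨z, hz⟩) (hΨ ⟨z, hz⟩)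
      (hΦ ⟨z, hz⟩)
  · ext x x'
    simp only [kernelOf, Matrix.of_apply]
    rw [← U.inner_map_map, hΦ, hΦ]
    exact inner_sum_conj_smul _ _ _ _ x x'

end Systems

/-! ### Kernel functions of the model operators -/

section Model

variable {X : Type*} {n : ℕ} (H : Type*) [NormedAddCommGroup H] [InnerProductSpace ℂ H]
  [CompleteSpace H] [RKHS ℂ H X (EuclideanSpace ℂ (Fin n))]

/-- The kernel function `K(·, z) eₓ`. -/
noncomputable def kernelVector (z : X) (x : Fin n) : H :=
  RKHS.kerFun H z (EuclideanSpace.single x 1)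

variable {H}

theorem inner_kernelVector (z : X) (x : Fin n) (f : H) : inner ℂ (kernelVector H z x) f = f z x := by
  simp [kernelVector, EuclideanSpace.inner_single_left]

theorem kernelMatrix_apply (μ lam : X) (x y : Fin n) :
    kernelMatrix H μ lam x y = inner ℂ (kernelVector H μ x) (kernelVector H lam y) := by
  rw [inner_kernelVector, kernelVector, RKHS.kerFun_apply, kernelMatrix, Matrix.of_apply]

end Model

theorem kernelMatrix_eq_kernelOf {D : Set ℂ} {n : ℕ} {H : Type*} [NormedAddCommGroup H]
    [InnerProductSpace ℂ H] [CompleteSpace H] [RKHS ℂ H D (EuclideanSpace ℂ (Fin n))] :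
    kernelMatrix H = kernelOf (kernelVector (X := D) H) := by
  ext μ lam x y
  exact kernelMatrix_apply μ lam x y

theorem IsAdjointMulModel.isKernelSystem {Ω : Set ℂ} {n : ℕ} {H : Type*} [NormedAddCommGroup H]
    [InnerProductSpace ℂ H] [CompleteSpace H]
    [RKHS ℂ H (conjDomain Ω) (EuclideanSpace ℂ (Fin n))] {T : H →L[ℂ] H}
    (hmodel : IsAdjointMulModel Ω n T) (hT : CowenDouglas Ω n T) :
    IsKernelSystem T (kernelVector (X := conjDomain Ω) H) := by
  have heigen : ∀ (z : conjDomain Ω) (x : Fin n),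
      T (kernelVector H z x) = conj (z : ℂ) • kernelVector H z x := fun z x => by
    refine ext_inner_right ℂ fun f => ?_
    rw [← ContinuousLinearMap.adjoint_inner_right, inner_kernelVector, hmodel.adjoint_apply,
      inner_smul_left, inner_kernelVector]
    simp
  have hind : ∀ z : conjDomain Ω, LinearIndependent ℂ (kernelVector H z) := fun z => by
    apply Matrix.linearIndependent_of_det_gram_ne_zero (𝕜 := ℂ)
    have : Matrix.gram ℂ (kernelVector H z) = kernelMatrix H z z := by
      ext x y
      rw [kernelMatrix_apply, Matrix.gram_apply]
    rw [this]
    exact ((Matrix.isUnit_iff_isUnit_det _).mp (hmodel.kernel_invertible z)).ne_zero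
  refine ⟨fun f hf => ?_, fun f x => ?_, heigen, hind, fun z f hf => ?_⟩
  · refine RKHS.ext fun z => ?_
    ext x
    rw [← inner_kernelVector, hf, RKHS.coe_zero]
    simp
  · obtain ⟨g, hg, hgz⟩ := hmodel.holomorphic f
    refine ⟨fun z => g z x, fun z hz => ?_, fun z => ?_⟩
    · exact (EuclideanSpace.proj (𝕜 := ℂ) x).differentiableAt.comp_differentiableWithinAt z
        (hg z hz)
    · rw [inner_kernelVector, ← hgz]
  · set S := LinearMap.ker (T - conj (z : ℂ) • ContinuousLinearMap.id ℂ H).toLinearMap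
    have hmem : ∀ g, g ∈ S ↔ T g = conj (z : ℂ) • g := fun g => by
      rw [← sub_eq_zero (a := T g)]
      exact Iff.rfl
    have hfin : Module.finrank ℂ S = n := hT.finrank_ker _ z.2
    -- `finrank` is `0` on infinite-dimensional spaces, so `0 < n` yields finite dimension; the `n`
    -- independent kernel vectors then fill the eigenspace.
    have : FiniteDimensional ℂ S := Module.finite_of_finrank_pos (hfin ▸ hT.rank_pos)
    have hle : Submodule.span ℂ (Set.range (kernelVector H z)) ≤ S := by
      rw [Submodule.span_le]
      rintro _ ⟨x, rfl⟩
      exact (hmem _).mpr (heigen z x)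
    have heq := Submodule.eq_of_le_of_finrank_eq hle (by
      rw [hfin, finrank_span_eq_card (hind z), Fintype.card_fin])
    rw [heq]
    exact (hmem f).mpr hf

/-! ### Kernel systems of direct sums with multiplicity -/

section DirectSum

variable {D : Set ℂ} {t : ℕ} {H : Fin t → Type*} [∀ i, NormedAddCommGroup (H i)]
  [∀ i, InnerProductSpace ℂ (H i)] {m n : Fin t → ℕ}

@[simp]
theorem multDirectSum_apply (T : ∀ i, H i →L[ℂ] H i) (f : PiLp 2 fun a : Copies m => H a.1)
    (a : Copies m) : multDirectSum m T f a = T a.1 (f a) := rfl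

theorem multDirectSum_single (T : ∀ i, H i →L[ℂ] H i) (a : Copies m) (v : H a.1) :
    multDirectSum m T (PiLp.single 2 a v) = PiLp.single 2 a (T a.1 v) := by
  ext b
  rw [multDirectSum_apply]
  by_cases h : b = a
  · subst h
    rw [PiLp.single_eq_same, PiLp.single_eq_same]
  · rw [PiLp.single_eq_of_ne _ h, PiLp.single_eq_of_ne _ h, map_zero]

theorem PiLp.inner_single_eq_inner_apply {ι : Type*} [Fintype ι] [DecidableEq ι] {E : ι → Type*}
    [∀ i, NormedAddCommGroup (E i)] [∀ i, InnerProductSpace ℂ (E i)] (a : ι) (v : E a)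
    (f : PiLp 2 E) : inner ℂ (PiLp.single 2 a v) f = inner ℂ v (f a) := by
  rw [PiLp.inner_apply, Finset.sum_eq_single a]
  · rw [PiLp.single_eq_same]
  · intro b _ hb
    rw [PiLp.single_eq_of_ne _ hb, inner_zero_left]
  · simp

theorem PiLp.sum_single_apply {ι : Type*} [Fintype ι] [DecidableEq ι] {E : ι → Type*}
    [∀ i, NormedAddCommGroup (E i)] (f : PiLp 2 E) : ∑ a, PiLp.single 2 a (f a) = f := by
  ext b
  rw [WithLp.ofLp_sum, Finset.sum_apply, Finset.sum_eq_single b]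
  · exact PiLp.single_eq_same ..
  · intro a _ hab
    exact PiLp.single_eq_of_ne _ (Ne.symm hab) _
  · simp

/-- The kernel vectors of a direct sum with multiplicities. -/
def sumVector (m : Fin t → ℕ) (k : ∀ i, D → Fin (n i) → H i) (z : D) (x : Coords m n) :
    PiLp 2 fun a : Copies m => H a.1 :=
  PiLp.single 2 x.1 (k x.1.1 z x.2)

theorem kernelOf_sumVector (k : ∀ i, D → Fin (n i) → H i) (μ lam : D) :
    kernelOf (sumVector m k) μ lam =
      Matrix.blockDiagonal' fun a : Copies m => kernelOf (k a.1) μ lam := by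
  ext ⟨a, x⟩ ⟨b, y⟩
  change inner ℂ (PiLp.single (β := fun a : Copies m => H a.1) 2 a (k a.1 μ x))
    (PiLp.single (β := fun a : Copies m => H a.1) 2 b (k b.1 lam y)) = _
  rw [PiLp.inner_single_eq_inner_apply]
  by_cases h : a = b
  · subst h
    rw [Matrix.blockDiagonal'_apply_eq, PiLp.single_eq_same]
    rfl
  · rw [Matrix.blockDiagonal'_apply_ne _ _ _ h, PiLp.single_eq_of_ne _ h, inner_zero_right]

theorem isKernelSystem_sumVector {T : ∀ i, H i →L[ℂ] H i} {k : ∀ i, D → Fin (n i) → H i}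
    (hk : ∀ i, IsKernelSystem (T i) (k i)) :
    IsKernelSystem (multDirectSum m T) (sumVector m k) := by
  refine ⟨fun f hf => ?_, fun f x => ?_, fun z x => ?_, fun z => ?_, fun z f hf => ?_⟩
  · ext a
    refine (hk a.1).separating _ fun z x => ?_
    exact (PiLp.inner_single_eq_inner_apply (E := fun a : Copies m => H a.1) a _ f).symm.trans
      (hf z ⟨a, x⟩)
  · obtain ⟨g, hg, hgz⟩ := (hk x.1.1).holomorphic (f x.1) x.2
    refine ⟨g, hg, fun z => ?_⟩
    rw [hgz, sumVector, PiLp.inner_single_eq_inner_apply]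
  · rw [sumVector, multDirectSum_single, (hk _).eigen]
    ext b
    by_cases h : b = x.1
    · subst h
      simp
    · simp [PiLp.single_eq_of_ne _ h]
  · exact PiLp.linearIndependent_single 2 ℂ (fun (a : Copies m) (x : Fin (n a.1)) => k a.1 z x)
      fun a => (hk a.1).linearIndependent z
  · rw [← PiLp.sum_single_apply f]
    refine Submodule.sum_mem _ fun a _ => ?_
    have h1 : T a.1 (f a) = conj (z : ℂ) • f a := by
      rw [← multDirectSum_apply, hf]
      rfl
    obtain ⟨c, hc⟩ := (Submodule.mem_span_range_iff_exists_fun ℂ).mp ((hk a.1).mem_span z _ h1)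
    have h2 : PiLp.single 2 a (f a) = ∑ x, c x • sumVector m k z ⟨a, x⟩ := by
      rw [← hc]
      ext b
      rw [WithLp.ofLp_sum, Finset.sum_apply]
      by_cases h : b = a
      · subst h
        rw [PiLp.single_eq_same]
        refine Finset.sum_congr rfl fun x _ => ?_
        simp [sumVector]
      · rw [PiLp.single_eq_of_ne _ h]
        symm
        refine Finset.sum_eq_zero fun x _ => ?_
        simp [sumVector, PiLp.single_eq_of_ne _ h]
    rw [h2]
    exact Submodule.sum_mem _ fun x _ => Submodule.smul_mem _ _ (Submodule.subset_span ⟨_, rfl⟩)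

end DirectSum

/-! ### Blocks of unitaries and the doubly stochastic matrix -/

section Blocks

variable {ι κ : Type*} [Fintype ι] [DecidableEq ι] [Fintype κ]
  {E : ι → Type*} [∀ i, NormedAddCommGroup (E i)] [∀ i, InnerProductSpace ℂ (E i)]
  {E' : κ → Type*} [∀ j, NormedAddCommGroup (E' j)] [∀ j, InnerProductSpace ℂ (E' j)]

/-- The component `E a → E' b` of an operator between Hilbert space direct sums. -/
noncomputable def operatorBlock (U : PiLp 2 E ≃ₗᵢ[ℂ] PiLp 2 E') (a : ι) (b : κ) :
    E a →L[ℂ] E' b :=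
  PiLp.proj 2 (𝕜 := ℂ) E' b ∘L (U : PiLp 2 E →L[ℂ] PiLp 2 E') ∘L
    (PiLp.continuousLinearEquiv 2 ℂ E).symm.toContinuousLinearMap ∘L
      ContinuousLinearMap.single ℂ E a

theorem operatorBlock_apply (U : PiLp 2 E ≃ₗᵢ[ℂ] PiLp 2 E') (a : ι) (b : κ) (v : E a) :
    operatorBlock U a b v = U (PiLp.single 2 a v) b := rfl

theorem inner_operatorBlock [DecidableEq κ] (U : PiLp 2 E ≃ₗᵢ[ℂ] PiLp 2 E') (a : ι) (b : κ)
    (v : E a) (w : E' b) :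
    inner ℂ (operatorBlock U a b v) w = inner ℂ v (operatorBlock U.symm b a w) := by
  rw [operatorBlock_apply, operatorBlock_apply, ← PiLp.inner_single_eq_inner_apply,
    ← inner_conj_symm (U (PiLp.single 2 a v) b), ← PiLp.inner_single_eq_inner_apply, inner_conj_symm,
    ← U.inner_map_map (PiLp.single 2 a v), LinearIsometryEquiv.apply_symm_apply]

/-- This is the `(a, a)` block of `U⁻¹ U = 1`; once each term is a scalar, it says that the scalars
sum to `1`. -/
theorem sum_operatorBlock_symm [DecidableEq κ] (U : PiLp 2 E ≃ₗᵢ[ℂ] PiLp 2 E') (a : ι) (v : E a) :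
    ∑ b, operatorBlock U.symm b a (operatorBlock U a b v) = v := by
  simp only [operatorBlock_apply]
  rw [← Finset.sum_apply
      (g := fun b => (U.symm (PiLp.single 2 b (U (PiLp.single 2 a v) b)) : ∀ i, E i)), ← WithLp.ofLp_sum,
    ← map_sum, PiLp.sum_single_apply, LinearIsometryEquiv.symm_apply_apply,
    PiLp.single_eq_same]

end Blocks

section Constants

variable {t s : ℕ} {m : Fin t → ℕ} {l : Fin s → ℕ}
  {H : Fin t → Type*} [∀ i, NormedAddCommGroup (H i)] [∀ i, InnerProductSpace ℂ (H i)]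
  {H' : Fin s → Type*} [∀ j, NormedAddCommGroup (H' j)] [∀ j, InnerProductSpace ℂ (H' j)]
  {T : ∀ i, H i →L[ℂ] H i} {T' : ∀ j, H' j →L[ℂ] H' j}

theorem operatorBlock_intertwines {U : PiLp 2 (fun a : Copies m => H a.1) ≃ₗᵢ[ℂ]
      PiLp 2 (fun b : Copies l => H' b.1)}
    (hU : ∀ f, U (multDirectSum m T f) = multDirectSum l T' (U f)) (a : Copies m) (b : Copies l)
    (v : H a.1) : operatorBlock U a b (T a.1 v) = T' b.1 (operatorBlock U a b v) := by
  rw [operatorBlock_apply, operatorBlock_apply, ← multDirectSum_single, hU, multDirectSum_apply]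

/-- The components of a unitary operator intertwining two direct sums of irreducible operators are
multiples of unitary operators, and the squared factors form a doubly stochastic matrix. -/
theorem exists_doublyStochastic_operatorBlock [∀ i, CompleteSpace (H i)]
    [∀ j, CompleteSpace (H' j)] [∀ i, Nontrivial (H i)] [∀ j, Nontrivial (H' j)]
    (hT : ∀ i, IsIrreducibleOperator (T i)) (hT' : ∀ j, IsIrreducibleOperator (T' j))
    {U : PiLp 2 (fun a : Copies m => H a.1) ≃ₗᵢ[ℂ] PiLp 2 (fun b : Copies l => H' b.1)}
    (hU : ∀ f, U (multDirectSum m T f) = multDirectSum l T' (U f)) :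
    ∃ c : Copies m → Copies l → ℝ, (∀ a b, 0 ≤ c a b) ∧ (∀ a, ∑ b, c a b = 1) ∧
      (∀ b, ∑ a, c a b = 1) ∧
      (∀ a b v, operatorBlock U.symm b a (operatorBlock U a b v) = (c a b : ℂ) • v) ∧
      (∀ a b w, operatorBlock U a b (operatorBlock U.symm b a w) = (c a b : ℂ) • w) ∧
      ∀ a b, c a b ≠ 0 → UnitarilyEquivalent (T a.1) (T' b.1) := by
  have hU' : ∀ f, U.symm (multDirectSum l T' f) = multDirectSum m T (U.symm f) := fun f => by
    rw [LinearIsometryEquiv.symm_apply_eq, hU, LinearIsometryEquiv.apply_symm_apply]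
  choose c hc hVU hUV heq using fun (a : Copies m) (b : Copies l) =>
    (hT a.1).schur (hT' b.1) (inner_operatorBlock U a b)
      (operatorBlock_intertwines hU a b) (operatorBlock_intertwines hU' b a)
  refine ⟨c, hc, fun a => ?_, fun b => ?_, hVU, hUV, heq⟩
  · obtain ⟨v, hv⟩ := exists_ne (0 : H a.1)
    have h := sum_operatorBlock_symm U a v
    simp only [hVU] at h
    rw [← Finset.sum_smul] at h
    have := smul_left_injective ℂ hv (h.trans (one_smul ℂ v).symm)
    exact_mod_cast this
  · obtain ⟨v, hv⟩ := exists_ne (0 : H' b.1)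
    have h := sum_operatorBlock_symm U.symm b v
    simp only [LinearIsometryEquiv.symm_symm, hUV] at h
    rw [← Finset.sum_smul] at h
    have := smul_left_injective ℂ hv (h.trans (one_smul ℂ v).symm)
    exact_mod_cast this

end Constants

/-! ### Matching of operators and multiplicities -/

/-- A doubly stochastic matrix indexed by copies and supported on a matching relation `R` matches
the indices bijectively and preserves the multiplicities. -/
theorem exists_equiv_of_doublyStochastic {t s : ℕ} {m : Fin t → ℕ} {l : Fin s → ℕ}
    (hm : ∀ i, 0 < m i) (hl : ∀ j, 0 < l j) {R : Fin t → Fin s → Prop}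
    (hR : ∀ i i' j, R i j → R i' j → i = i') (hR' : ∀ i j j', R i j → R i j' → j = j')
    {c : Copies m → Copies l → ℝ} (hrow : ∀ a, ∑ b, c a b = 1) (hcol : ∀ b, ∑ a, c a b = 1)
    (hc : ∀ a b, c a b ≠ 0 → R a.1 b.1) : ∃ π : Fin t ≃ Fin s, ∀ i, R i (π i) ∧ m i = l (π i) := by
  have hex : ∀ i, ∃ j, R i j := fun i => by
    obtain ⟨b, -, hb⟩ := Finset.exists_ne_zero_of_sum_ne_zero
      (by rw [hrow ⟨i, ⟨0, hm i⟩⟩]; exact one_ne_zero)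
    exact ⟨b.1, hc _ _ hb⟩
  have hex' : ∀ j, ∃ i, R i j := fun j => by
    obtain ⟨a, -, ha⟩ := Finset.exists_ne_zero_of_sum_ne_zero
      (by rw [hcol ⟨j, ⟨0, hl j⟩⟩]; exact one_ne_zero)
    exact ⟨a.1, hc _ _ ha⟩
  choose f hf using hex
  have hbij : Function.Bijective f := by
    refine ⟨fun i i' h => hR i i' (f i) (hf i) (h ▸ hf i'), fun j => ?_⟩
    obtain ⟨i, hi⟩ := hex' j
    exact ⟨i, hR' i _ _ (hf i) hi⟩
  refine ⟨Equiv.ofBijective f hbij, fun i => ⟨hf i, ?_⟩⟩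
  change m i = l (f i)
  -- All the mass of the rows of `i` and of the columns of `f i` lies in this rectangle, so its
  -- total is `m i` by rows and `l (f i)` by columns.
  have h1 : ∑ p : Fin (m i), ∑ q : Fin (l (f i)), c ⟨i, p⟩ ⟨f i, q⟩ = m i := by
    have : ∀ p : Fin (m i), ∑ q : Fin (l (f i)), c ⟨i, p⟩ ⟨f i, q⟩ = 1 := fun p => by
      rw [← hrow ⟨i, p⟩, Fintype.sum_sigma, Finset.sum_eq_single (f i)]
      · intro j _ hj
        refine Finset.sum_eq_zero fun q _ => ?_
        by_contra h
        exact hj (hR' i _ _ (hc _ _ h) (hf i))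
      · simp
    simp [this]
  have h2 : ∑ q : Fin (l (f i)), ∑ p : Fin (m i), c ⟨i, p⟩ ⟨f i, q⟩ = l (f i) := by
    have : ∀ q : Fin (l (f i)), ∑ p : Fin (m i), c ⟨i, p⟩ ⟨f i, q⟩ = 1 := fun q => by
      rw [← hcol ⟨f i, q⟩, Fintype.sum_sigma, Finset.sum_eq_single i]
      · intro j _ hj
        refine Finset.sum_eq_zero fun q _ => ?_
        by_contra h
        exact hj (hR _ _ _ (hc _ _ h) (hf i))
      · simp
    simp [this]
  rw [Finset.sum_comm, h2] at h1
  exact_mod_cast h1.symm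

theorem sumKernel_eq_kernelOf {D : Set ℂ} {t : ℕ} (m n : Fin t → ℕ) (H : Fin t → Type*)
    [∀ i, NormedAddCommGroup (H i)] [∀ i, InnerProductSpace ℂ (H i)] [∀ i, CompleteSpace (H i)]
    [∀ i, RKHS ℂ (H i) D (EuclideanSpace ℂ (Fin (n i)))] :
    sumKernel m n H = kernelOf (D := D) (sumVector m fun i => kernelVector (H i)) := by
  funext μ lam
  rw [kernelOf_sumVector, sumKernel]
  simp only [kernelMatrix_eq_kernelOf]

/-! ### Blocks of the matrix solution -/

section Components

variable {D : Set ℂ} {t s : ℕ} {m n : Fin t → ℕ} {l h : Fin s → ℕ}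
  {H : Fin t → Type*} [∀ i, NormedAddCommGroup (H i)] [∀ i, InnerProductSpace ℂ (H i)]
  {H' : Fin s → Type*} [∀ j, NormedAddCommGroup (H' j)] [∀ j, InnerProductSpace ℂ (H' j)]

theorem sum_smul_sumVector_apply (k : ∀ i, D → Fin (n i) → H i) (z : D) (w : Coords m n → ℂ)
    (a : Copies m) :
    (∑ x, w x • sumVector m k z x) a = ∑ x, w ⟨a, x⟩ • k a.1 z x := by
  rw [WithLp.ofLp_sum, Finset.sum_apply, Fintype.sum_sigma, Finset.sum_eq_single a]
  · refine Finset.sum_congr rfl fun x _ => ?_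
    simp [sumVector]
  · intro b _ hb
    refine Finset.sum_eq_zero fun x _ => ?_
    simp [sumVector, PiLp.single_eq_of_ne _ (Ne.symm hb)]
  · simp

theorem operatorBlock_apply_eq_sum {k : ∀ i, D → Fin (n i) → H i} {k' : ∀ j, D → Fin (h j) → H' j}
    {U : PiLp 2 (fun a : Copies m => H a.1) ≃ₗᵢ[ℂ] PiLp 2 (fun b : Copies l => H' b.1)} {z : D}
    {A : Matrix (Coords m n) (Coords l h) ℂ}
    (hU : ∀ x, U (sumVector m k z x) = ∑ y, conj (A x y) • sumVector l k' z y)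
    (a : Copies m) (b : Copies l) (x : Fin (n a.1)) :
    operatorBlock U a b (k a.1 z x) = ∑ y, conj (summandBlock A a b x y) • k' b.1 z y := by
  have h1 := hU ⟨a, x⟩
  rw [operatorBlock_apply]
  change U (sumVector m k z ⟨a, x⟩) b = _
  rw [h1, sum_smul_sumVector_apply]
  rfl

theorem isotypicBlock_eq_zero_iff (A : Matrix (Coords m n) (Coords l h) ℂ) (i : Fin t) (j : Fin s) :
    isotypicBlock A i j = 0 ↔ ∀ p q, summandBlock A ⟨i, p⟩ ⟨j, q⟩ = 0 := by
  constructor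
  · intro hA p q
    ext x y
    exact congrFun (congrFun hA (p, x)) (q, y)
  · intro hA
    ext ⟨p, x⟩ ⟨q, y⟩
    exact congrFun (congrFun (hA p q) x) y

end Components

/-- Block structure of the holomorphic solutions of `K = Φ K' Φ*` for two direct sums of
irreducible operators. -/
theorem exists_doublyStochastic_summandBlock {D : Set ℂ} (hD : IsOpen D) (hDc : IsPreconnected D)
    {t s : ℕ} {m n : Fin t → ℕ} {l h : Fin s → ℕ}
    {H : Fin t → Type*} [∀ i, NormedAddCommGroup (H i)] [∀ i, InnerProductSpace ℂ (H i)]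
    [∀ i, CompleteSpace (H i)] [∀ i, Nontrivial (H i)]
    {H' : Fin s → Type*} [∀ j, NormedAddCommGroup (H' j)] [∀ j, InnerProductSpace ℂ (H' j)]
    [∀ j, CompleteSpace (H' j)] [∀ j, Nontrivial (H' j)]
    {T : ∀ i, H i →L[ℂ] H i} {T' : ∀ j, H' j →L[ℂ] H' j}
    (hT : ∀ i, IsIrreducibleOperator (T i)) (hT' : ∀ j, IsIrreducibleOperator (T' j))
    {k : ∀ i, D → Fin (n i) → H i} {k' : ∀ j, D → Fin (h j) → H' j}
    (hk : ∀ i, IsKernelSystem (T i) (k i)) (hk' : ∀ j, IsKernelSystem (T' j) (k' j))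
    {L : Set ℂ} (hL : L ⊆ D) (hLo : IsOpen L) (hLn : L.Nonempty)
    {Φ : ℂ → Matrix (Coords m n) (Coords l h) ℂ}
    (hΦ : IntertwinesKernels hL (kernelOf (sumVector m k)) (kernelOf (sumVector l k')) Φ) :
    ∃ c : Copies m → Copies l → ℝ,
      (∀ a b, 0 ≤ c a b) ∧ (∀ a, ∑ b, c a b = 1) ∧ (∀ b, ∑ a, c a b = 1) ∧
      (∀ z ∈ L, ∀ Ψ : Matrix (Coords l h) (Coords m n) ℂ, Φ z * Ψ = 1 → Ψ * Φ z = 1 →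
        ∀ a b, summandBlock (Φ z) a b * summandBlock Ψ b a = (c a b : ℂ) • 1 ∧
          summandBlock Ψ b a * summandBlock (Φ z) a b = (c a b : ℂ) • 1) ∧
      (∀ μ lam (hμ : μ ∈ L) (hlam : lam ∈ L) a b,
        (c a b : ℂ) • kernelOf (k a.1) ⟨μ, hL hμ⟩ ⟨lam, hL hlam⟩ =
          summandBlock (Φ μ) a b * kernelOf (k' b.1) ⟨μ, hL hμ⟩ ⟨lam, hL hlam⟩ *
            (summandBlock (Φ lam) a b)ᴴ) ∧
      (∀ a b, c a b ≠ 0 → UnitarilyEquivalent (T a.1) (T' b.1)) ∧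
      ∀ a b, c a b = 0 → ∀ z ∈ L, summandBlock (Φ z) a b = 0 := by
  obtain ⟨U, hU, hUΦ⟩ := exists_unitary_of_intertwinesKernels (isKernelSystem_sumVector hk)
    (isKernelSystem_sumVector hk') hD hDc hL hLo hLn hΦ
  obtain ⟨c, hc0, hrow, hcol, hVU, hUV, heq⟩ := exists_doublyStochastic_operatorBlock hT hT' hU
  have hblock : ∀ z (hz : z ∈ L) a b x, operatorBlock U a b (k a.1 ⟨z, hL hz⟩ x) =
      ∑ y, conj (summandBlock (Φ z) a b x y) • k' b.1 ⟨z, hL hz⟩ y := fun z hz =>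
    operatorBlock_apply_eq_sum (hUΦ z hz)
  refine ⟨c, hc0, hrow, hcol, fun z hz Ψ h1 h2 a b => ?_, fun μ lam hμ hlam a b => ?_, heq,
    fun a b h0 z hz => ?_⟩
  · have hblock' := operatorBlock_apply_eq_sum (U := U.symm) (k := k') (k' := k)
      (symm_apply_of_apply_eq_sum h2 (hUΦ z hz)) b a
    exact ⟨mul_eq_smul_one_of_apply_eq_sum (hVU a b) ((hk a.1).linearIndependent _)
        (hblock z hz a b) hblock',
      mul_eq_smul_one_of_apply_eq_sum (hUV a b) ((hk' b.1).linearIndependent _) hblock'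
        (hblock z hz a b)⟩
  · ext x y
    have h1 := inner_operatorBlock U a b (k a.1 ⟨μ, hL hμ⟩ x)
      (operatorBlock U a b (k a.1 ⟨lam, hL hlam⟩ y))
    rw [hVU, inner_smul_right, hblock μ hμ, hblock lam hlam] at h1
    exact h1.symm.trans (inner_sum_conj_smul _ _ _ _ x y)
  · ext x y
    have h1 : ∑ y, conj (summandBlock (Φ z) a b x y) • k' b.1 ⟨z, hL hz⟩ y = 0 := by
      -- For the operator block `V` of `U`, `‖V k‖² = ⟨k, V* V k⟩ = c ‖k‖² = 0`.
      rw [← hblock z hz, ← inner_self_eq_zero (𝕜 := ℂ), inner_operatorBlock, hVU, h0]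
      simp
    have h2 := Fintype.linearIndependent_iff.mp ((hk' b.1).linearIndependent ⟨z, hL hz⟩) _ h1 y
    simpa using h2

/-! ### The main theorem -/

theorem CowenDouglas.nontrivial {Ω : Set ℂ} (hΩ : Ω.Nonempty) {n : ℕ} {H : Type*}
    [NormedAddCommGroup H] [InnerProductSpace ℂ H] {T : H →L[ℂ] H} (hT : CowenDouglas Ω n T) :
    Nontrivial H := by
  obtain ⟨w, hw⟩ := hΩ
  by_contra hn
  rw [not_nontrivial_iff_subsingleton] at hn
  have h1 := hT.finrank_ker w hw
  rw [Module.finrank_zero_of_subsingleton] at h1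
  exact hT.rank_pos.ne h1

theorem mainTheorem7 (Ω : Set ℂ) (hΩ : IsOpen Ω) (hΩc : IsConnected Ω) (N : ℕ)
    {t s : ℕ} (m n : Fin t → ℕ) (l h : Fin s → ℕ)
    (H : Fin t → Type*) [∀ i, NormedAddCommGroup (H i)] [∀ i, InnerProductSpace ℂ (H i)]
    [∀ i, CompleteSpace (H i)]
    [∀ i, RKHS ℂ (H i) (conjDomain Ω) (EuclideanSpace ℂ (Fin (n i)))]
    (H' : Fin s → Type*) [∀ j, NormedAddCommGroup (H' j)] [∀ j, InnerProductSpace ℂ (H' j)]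
    [∀ j, CompleteSpace (H' j)]
    [∀ j, RKHS ℂ (H' j) (conjDomain Ω) (EuclideanSpace ℂ (Fin (h j)))]
    (T : ∀ i, H i →L[ℂ] H i) (T' : ∀ j, H' j →L[ℂ] H' j)
    (hmodel : ∀ i, IsAdjointMulModel Ω (n i) (T i))
    (hmodel' : ∀ j, IsAdjointMulModel Ω (h j) (T' j))
    (hT : IsIRDecomposition Ω N m n T) (hT' : IsIRDecomposition Ω N l h T')
    (hequiv : UnitarilyEquivalent (multDirectSum m T) (multDirectSum l T')) :
    t = s ∧
    (∃ Φ : ℂ → Matrix (Coords m n) (Coords l h) ℂ,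
      IntertwinesKernels (subset_refl (conjDomain Ω)) (sumKernel m n H) (sumKernel l h H') Φ) ∧
    ∃ π : Fin t ≃ Fin s,
      (∀ i, UnitarilyEquivalent (T i) (T' (π i)) ∧ m i = l (π i)) ∧
      ∀ (L : Set ℂ) (hL : L ⊆ conjDomain Ω), IsOpen L → L.Nonempty →
        ∀ Φ : ℂ → Matrix (Coords m n) (Coords l h) ℂ,
          IntertwinesKernels hL (sumKernel m n H) (sumKernel l h H') Φ →
          (∀ i, (∀ z ∈ L, isotypicBlock (Φ z) i (π i) ≠ 0) ∧
            ∀ j, j ≠ π i → ∀ z ∈ L, isotypicBlock (Φ z) i j = 0) ∧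
          (∀ (a : Copies m) (b : Copies l),
            (∀ z ∈ L, MatrixInvertible (summandBlock (Φ z) a b)) ∨
            (∀ z ∈ L, summandBlock (Φ z) a b = 0)) ∧
          ∃ c : Copies m → Copies l → ℝ,
            (∀ a b, 0 ≤ c a b) ∧ (∀ a, ∑ b, c a b = 1) ∧ (∀ b, ∑ a, c a b = 1) ∧
            (∀ z ∈ L, ∀ Ψ : Matrix (Coords l h) (Coords m n) ℂ, Φ z * Ψ = 1 → Ψ * Φ z = 1 →
              ∀ a b, summandBlock (Φ z) a b * summandBlock Ψ b a = (c a b : ℂ) • 1 ∧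
                summandBlock Ψ b a * summandBlock (Φ z) a b = (c a b : ℂ) • 1) ∧
            ∀ μ lam (hμ : μ ∈ L) (hlam : lam ∈ L) a b,
              (c a b : ℂ) • kernelMatrix (H a.1) ⟨μ, hL hμ⟩ ⟨lam, hL hlam⟩ =
                summandBlock (Φ μ) a b * kernelMatrix (H' b.1) ⟨μ, hL hμ⟩ ⟨lam, hL hlam⟩ *
                  (summandBlock (Φ lam) a b)ᴴ := by
  have hD := isOpen_conjDomain hΩ
  have hDc := isPreconnected_conjDomain hΩc.isPreconnected
  have hk := fun i => (hmodel i).isKernelSystem (hT.summand_mem i)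
  have hk' := fun j => (hmodel' j).isKernelSystem (hT'.summand_mem j)
  have : ∀ i, Nontrivial (H i) := fun i => (hT.summand_mem i).nontrivial hΩc.nonempty
  have : ∀ j, Nontrivial (H' j) := fun j => (hT'.summand_mem j).nontrivial hΩc.nonempty
  have hR : ∀ i i' j, UnitarilyEquivalent (T i) (T' j) → UnitarilyEquivalent (T i') (T' j) →
      i = i' := fun i i' j h1 h2 => by
    by_contra hne
    exact hT.not_equivalent i i' hne (h1.trans h2.symm)
  have hR' : ∀ i j j', UnitarilyEquivalent (T i) (T' j) → UnitarilyEquivalent (T i) (T' j') →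
      j = j' := fun i j j' h1 h2 => by
    by_contra hne
    exact hT'.not_equivalent j j' hne (h1.symm.trans h2)
  -- The bijection `π` comes from this one unitary, before `L` and `Φ` are chosen. Every other `Φ`
  -- respects it because `π i` is the only index whose operator is equivalent to `T i`.
  obtain ⟨U, hU⟩ := hequiv
  obtain ⟨c₀, -, hrow₀, hcol₀, -, -, heq₀⟩ :=
    exists_doublyStochastic_operatorBlock hT.irreducible hT'.irreducible hU
  obtain ⟨π, hπ⟩ :=
    exists_equiv_of_doublyStochastic hT.mult_pos hT'.mult_pos hR hR' hrow₀ hcol₀ heq₀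
  refine ⟨Fin.equiv_iff_eq.mp ⟨π⟩, ?_, π, hπ, fun L hL hLo hLn Φ hΦ => ?_⟩
  · rw [sumKernel_eq_kernelOf, sumKernel_eq_kernelOf]
    exact exists_intertwinesKernels_of_unitary (isKernelSystem_sumVector hk)
      (isKernelSystem_sumVector hk') hD U hU
  rw [sumKernel_eq_kernelOf, sumKernel_eq_kernelOf] at hΦ
  obtain ⟨c, hc0, hrow, hcol, hinv, hker, heq, hzero⟩ := exists_doublyStochastic_summandBlock
    hD hDc hT.irreducible hT'.irreducible hk hk' hL hLo hLn hΦ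
  have hunit : ∀ a b, c a b ≠ 0 → ∀ z ∈ L, MatrixInvertible (summandBlock (Φ z) a b) := by
    intro a b hab z hz
    obtain ⟨Ψ, h1, h2⟩ := hΦ.invertible z hz
    have hab' : (c a b : ℂ) ≠ 0 := by exact_mod_cast hab
    refine ⟨(c a b : ℂ)⁻¹ • summandBlock Ψ b a, ?_, ?_⟩
    · rw [Matrix.mul_smul, (hinv z hz Ψ h1 h2 a b).1, smul_smul, inv_mul_cancel₀ hab', one_smul]
    · rw [Matrix.smul_mul, (hinv z hz Ψ h1 h2 a b).2, smul_smul, inv_mul_cancel₀ hab', one_smul]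
  refine ⟨fun i => ⟨fun z hz h0 => ?_, fun j hj z hz => ?_⟩, fun a b => ?_, c, hc0, hrow, hcol, hinv,
    ?_⟩
  -- A row of `c` over the first copy of `T i` sums to `1`, so it has a non-zero entry, necessarily
  -- over `π i`. That summand block is invertible of size `n i > 0`, hence not zero.
  · obtain ⟨⟨j, q⟩, -, hb⟩ := Finset.exists_ne_zero_of_sum_ne_zero
      (by rw [hrow ⟨i, ⟨0, hT.mult_pos i⟩⟩]; exact one_ne_zero)
    obtain rfl : j = π i := hR' i _ _ (heq _ _ hb) (hπ i).1
    obtain ⟨B, hB, -⟩ := hunit _ _ hb z hz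
    rw [(isotypicBlock_eq_zero_iff _ _ _).mp h0, Matrix.zero_mul] at hB
    have h1 := congrFun (congrFun hB ⟨0, (hT.summand_mem i).rank_pos⟩)
      ⟨0, (hT.summand_mem i).rank_pos⟩
    simp at h1
  · refine (isotypicBlock_eq_zero_iff _ _ _).mpr fun p q => hzero _ _ ?_ z hz
    by_contra hne
    exact hj (hR' i _ _ (heq _ _ hne) (hπ i).1)
  · by_cases hab : c a b = 0
    · exact Or.inr (hzero a b hab)
    · exact Or.inl (hunit a b hab)
  · simpa only [kernelMatrix_eq_kernelOf] using hker
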